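/- Let $q\ge 3$ be an integer, $\lambda_q=2\cos(\pi/q)$, and let $G_q\subset PSL(2,\mathbb R)$ be the Hecke group generated by the classes of $S=\begin{pmatrix}0&1\\-1&0\end{pmatrix}$ and $T=\begin{pmatrix}1&\lambda_q\\0&1\end{pmatrix}$. For $x,y\in\mathbb Z[\lambda_q]$ with $y\ne0$ there is a unique integer $m$ such that $x=y(m\lambda_q)+r$ with $-|y\lambda_q|/2<r\le|y\lambda_q|/2$; call $r$ the remainder of $x$ by $y$. For $a,b\in\mathbb Z[\lambda_q]$ with $ab\neq0$, put $r_{-1}=a$, $r_0=b$ and, as long as $r_k\neq0$, let $r_{k+1}$ be the remainder of $r_{k-1}$ by $r_k$. If this terminates, that is, $r_n\ne0$ and $r_{n+1}=0$ for some $n\ge 0$, define $(a,b)_q=|r_n|$; if it does not terminate, define $(a,b)_q=0$. Define also $(a,0)_q=(0,a)_q=|a|$. **Proposition 3.7.** Let $A=\begin{pmatrix}a&c\\b&d\end{pmatrix}\in PSL(2,\mathbb Z[\lambda_q])$. Then $A\in G_q$ if and only if $(a,b)_q=(c,d)_q=1$. In particular, if $(a,b)_q<1$, or if $b\neq0$ and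 $|b|<1$, then $A\notin G_q$. -/

import Mathlib

namespace Hecke

open Matrix

/-- `λ_q = 2 cos (π / q)`. -/
noncomputable def lam (q : ℕ) : ℝ := 2 * Real.cos (Real.pi / q)

/-- The ring `ℤ[λ_q]`, as a subalgebra of `ℝ`. -/
noncomputable abbrev lamRing (q : ℕ) : Subalgebra ℤ ℝ := Algebra.adjoin ℤ {lam q}

/-- `λ_q` as an element of `ℤ[λ_q]`. -/
noncomputable def lamElt (q : ℕ) : lamRing q :=
  ⟨lam q, Algebra.subset_adjoin (Set.mem_singleton _)⟩

/-- The generator `S = (0 1; -1 0)`. -/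
noncomputable def matS : SpecialLinearGroup (Fin 2) ℝ :=
  ⟨!![0, 1; -1, 0], by simp [Matrix.det_fin_two]⟩

/-- The generator `T = (1 λ_q; 0 1)`. -/
noncomputable def matT (q : ℕ) : SpecialLinearGroup (Fin 2) ℝ :=
  ⟨!![1, lam q; 0, 1], by simp [Matrix.det_fin_two]⟩

/-- The (inhomogeneous) Hecke group `G_q`: the subgroup of `PSL(2, ℝ)` generated by the classes
of `S` and `T`. -/
noncomputable def heckeGroup (q : ℕ) : Subgroup (ProjectiveSpecialLinearGroup (Fin 2) ℝ) :=
  Subgroup.closure {QuotientGroup.mk matS, QuotientGroup.mk (matT q)}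

theorem center_le_comap (q : ℕ) :
    Subgroup.center (SpecialLinearGroup (Fin 2) (lamRing q)) ≤
      (Subgroup.center (SpecialLinearGroup (Fin 2) ℝ)).comap
        (SpecialLinearGroup.map (algebraMap (lamRing q) ℝ)) := by
  intro A hA
  rw [Matrix.SpecialLinearGroup.mem_center_iff] at hA
  rw [Subgroup.mem_comap, Matrix.SpecialLinearGroup.mem_center_iff]
  obtain ⟨r, hr, h⟩ := hA
  refine ⟨algebraMap (lamRing q) ℝ r, by rw [← map_pow, hr, map_one], ?_⟩
  rw [Matrix.SpecialLinearGroup.map_apply_coe, ← h]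
  ext i j
  by_cases hij : i = j <;> simp [hij]

/-- The natural map `PSL(2, ℤ[λ_q]) → PSL(2, ℝ)` induced by the inclusion `ℤ[λ_q] ⊆ ℝ`. -/
noncomputable def toPSLReal (q : ℕ) :
    ProjectiveSpecialLinearGroup (Fin 2) (lamRing q) →*
      ProjectiveSpecialLinearGroup (Fin 2) ℝ :=
  QuotientGroup.map _ _ (SpecialLinearGroup.map (algebraMap (lamRing q) ℝ)) (center_le_comap q)

/-- The quotient of one step of the pseudo-Euclidean algorithm: for `y ≠ 0`, the unique integer
`m` such that `x = y (m λ_q) + r` with `-|y λ_q| / 2 < r ≤ |y λ_q| / 2`; that it is this integer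
is proved in `peQuot_unique` below. -/
noncomputable def peQuot (q : ℕ) (x y : lamRing q) : ℤ :=
  (SignType.sign (y : ℝ) : ℤ) * ⌈(x : ℝ) / |(y : ℝ) * lam q| - 1 / 2⌉

/-- The remainder `r = x - y (m λ_q)` of one step of the pseudo-Euclidean algorithm. -/
noncomputable def peRem (q : ℕ) (x y : lamRing q) : lamRing q :=
  x - y * ((peQuot q x y : lamRing q) * lamElt q)

/-- The pairs of consecutive remainders of the pseudo-Euclidean algorithm: with `r₋₁ = a` and
`r₀ = b`, the `n`-th pair is `(rₙ₋₁, rₙ)`; once a remainder vanishes the sequence stays `0`. -/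
noncomputable def peState (q : ℕ) (a b : lamRing q) : ℕ → lamRing q × lamRing q
  | 0 => (a, b)
  | n + 1 =>
    ((peState q a b n).2,
      open Classical in
      if (peState q a b n).2 = 0 then 0 else peRem q (peState q a b n).1 (peState q a b n).2)

/-- The `n`-th remainder `rₙ`, where `r₀ = b`. -/
noncomputable def rem (q : ℕ) (a b : lamRing q) (n : ℕ) : lamRing q := (peState q a b n).2

open Classical in
/-- The pseudo-Euclidean gcd `(a, b)_q`: equal to `|rₙ|` if `a b ≠ 0` and the algorithm terminates
with last non-zero remainder `rₙ`, to `0` if it does not terminate, and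
`(a, 0)_q = (0, a)_q = |a|`. -/
noncomputable def peGcd (q : ℕ) (a b : lamRing q) : ℝ :=
  if b = 0 then |(a : ℝ)|
  else if a = 0 then |(b : ℝ)|
  else if h : ∃ n, rem q a b n ≠ 0 ∧ rem q a b (n + 1) = 0 then
    |(rem q a b (Nat.find h) : ℝ)|
  else 0

theorem lam_pos {q : ℕ} (hq : 3 ≤ q) : 0 < lam q := by
  have h3 : (3 : ℝ) ≤ q := by exact_mod_cast hq
  have hpi := Real.pi_pos
  refine mul_pos two_pos (Real.cos_pos_of_mem_Ioo ⟨?_, ?_⟩)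
  · have : 0 < Real.pi / q := by positivity
    linarith
  · rw [div_lt_div_iff₀ (by linarith) two_pos]
    nlinarith

theorem peQuot_unique {q : ℕ} (hq : 3 ≤ q) (x y : lamRing q) (hy : y ≠ 0) (m : ℤ) :
    (-|(y : ℝ) * lam q| / 2 < (x : ℝ) - y * (m * lam q) ∧
      (x : ℝ) - y * (m * lam q) ≤ |(y : ℝ) * lam q| / 2) ↔ m = peQuot q x y := by
  have hl := lam_pos hq
  obtain ⟨x, hx⟩ := x
  obtain ⟨y, hym⟩ := y
  have hy0 : y ≠ 0 := fun h => hy (Subtype.ext h)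
  have key : ∀ p : ℝ, 0 < p → ∀ k : ℤ,
      (-p / 2 < x - p * k ∧ x - p * k ≤ p / 2) ↔ k = ⌈x / p - 1 / 2⌉ := by
    intro p hp k
    rw [eq_comm, Int.ceil_eq_iff]
    have e : x = x / p * p := by field_simp
    constructor
    · rintro ⟨h1, h2⟩
      constructor
      · by_contra hc
        nlinarith
      · by_contra hc
        nlinarith
    · rintro ⟨h1, h2⟩
      constructor <;> nlinarith
  unfold peQuot
  simp only
  rcases lt_or_gt_of_ne hy0 with h | h
  · have hp : |y * lam q| = -(y * lam q) := abs_of_neg (mul_neg_of_neg_of_pos h hl)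
    have := key (-(y * lam q)) (by nlinarith) (-m)
    rw [hp, sign_neg h]
    simp only [SignType.coe_neg, SignType.coe_one, one_mul, neg_mul, Int.cast_neg] at this ⊢
    rw [show x - -(y * lam q * -(m : ℝ)) = x - y * (m * lam q) by ring] at this
    rw [this]
    constructor <;> intro h <;> linarith
  · have hp : |y * lam q| = y * lam q := abs_of_pos (mul_pos h hl)
    have := key (y * lam q) (mul_pos h hl) m
    rw [hp, sign_pos h]
    simp only [SignType.coe_one, one_mul] at this ⊢
    rw [show x - y * lam q * (m : ℝ) = x - y * (m * lam q) by ring] at this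
    rw [this]

end Hecke

/-!
Write `Γ` for the subgroup of `SL(2, ℝ)` generated by `S` and `T`; it contains `-1`, so it is the
full preimage of the Hecke group. The key fact is that a nonzero entry of an element of `Γ` has
absolute value at least `1`. With `s j = sin (j π / q) / sin (π / q)`, the matrices
`V j = (s (j + 1), s (j + 2); s j, s (j + 1))`, `0 ≤ j ≤ q - 2`, have all entries in `{0} ∪ [1, ∞)`,
a set closed under sums and products. Now `T = V 0`, `T S V j = -V (j + 1)` and `V (q - 1) = -S`,
so, up to sign and up to a factor `S` on the left, every column of an element of `Γ` is a product
of matrices `V j` applied to a basis vector (`PosCol`, `IsCol.signedPosCol`).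

One step of the pseudo-Euclidean algorithm multiplies the column of two consecutive remainders by
an element of `Γ`, up to a sign (`isCol_peRem_iff`). If `(a, b)` is a column of `Γ`, then all
nonzero remainders are at least `1` in absolute value while they shrink by the factor
`λ / 2 < 1`, so the algorithm ends at a column `(r, 0)`, where `|r| = 1`. Conversely, if the
algorithm ends with `±1`, then `(a, b)` is a column of `Γ`. This gives
`peGcd q a b = 1 ↔ IsCol q a b` (`peGcd_eq_one_iff`).

Finally, let both columns of a matrix `A` of determinant `1` be columns of `Γ`, the first one of
`g ∈ Γ`. Then `g⁻¹ A` is `(1, e; 0, 1)` and `(e, 1)` is a column of `Γ`. Subtracting a multiple of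
`λ` brings `|e|` below `1`, so `e` is a multiple of `λ`, and `A ∈ Γ`.
-/

namespace Hecke

/-! ### Nonnegative reals without values strictly between 0 and 1 -/

/-- The real numbers that are `0` or at least `1`. -/
def ZeroOrGeOne (x : ℝ) : Prop := x = 0 ∨ 1 ≤ x

theorem ZeroOrGeOne.nonneg {x : ℝ} (h : ZeroOrGeOne x) : 0 ≤ x := by
  rcases h with h | h <;> linarith

theorem ZeroOrGeOne.add {x y : ℝ} (hx : ZeroOrGeOne x) (hy : ZeroOrGeOne y) :
    ZeroOrGeOne (x + y) := by
  rcases hx with rfl | hx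
  · simpa using hy
  · exact Or.inr (by linarith [hy.nonneg])

theorem ZeroOrGeOne.mul {x y : ℝ} (hx : ZeroOrGeOne x) (hy : ZeroOrGeOne y) :
    ZeroOrGeOne (x * y) := by
  rcases hx with rfl | hx
  · exact Or.inl (zero_mul y)
  · rcases hy with rfl | hy
    · exact Or.inl (mul_zero x)
    · exact Or.inr (one_le_mul_of_one_le_of_one_le hx hy)

/-! ### The sine quotients -/

/-- `sin (j π / q) / sin (π / q)`, the Chebyshev polynomial of the second kind of index `j - 1`
at `cos (π / q)`. -/
noncomputable def sinQuot (q j : ℕ) : ℝ :=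
  Real.sin (j * (Real.pi / q)) / Real.sin (Real.pi / q)

section sinQuot

variable {q : ℕ}

theorem sin_pi_div_pos (hq : 3 ≤ q) : 0 < Real.sin (Real.pi / q) := by
  have h3 : (3 : ℝ) ≤ q := by exact_mod_cast hq
  apply Real.sin_pos_of_pos_of_lt_pi
  · have := Real.pi_pos
    positivity
  · exact div_lt_self Real.pi_pos (by linarith)

theorem lam_lt_two (hq : 3 ≤ q) : lam q < 2 := by
  have h := Real.sin_sq_add_cos_sq (Real.pi / q)
  have hs := sin_pi_div_pos hq
  have : Real.cos (Real.pi / q) < 1 := by nlinarith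
  unfold lam
  linarith

theorem sinQuot_zero : sinQuot q 0 = 0 := by simp [sinQuot]

theorem sinQuot_one (hq : 3 ≤ q) : sinQuot q 1 = 1 := by
  simp [sinQuot, (sin_pi_div_pos hq).ne']

theorem sinQuot_add_two (j : ℕ) :
    sinQuot q (j + 2) = lam q * sinQuot q (j + 1) - sinQuot q j := by
  have h : ∀ t : ℝ, Real.sin ((j + 2 : ℝ) * t) =
      2 * Real.cos t * Real.sin ((j + 1 : ℝ) * t) - Real.sin (j * t) := by
    intro t
    have h1 : (j + 2 : ℝ) * t = (j + 1 : ℝ) * t + t := by ring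
    have h2 : (j : ℝ) * t = (j + 1 : ℝ) * t - t := by ring
    rw [h1, h2, Real.sin_add, Real.sin_sub]
    ring
  unfold sinQuot lam
  push_cast
  rw [h]
  ring

theorem sinQuot_two (hq : 3 ≤ q) : sinQuot q 2 = lam q := by
  rw [show 2 = 0 + 2 from rfl, sinQuot_add_two, sinQuot_zero, zero_add, sinQuot_one hq]
  ring

theorem sinQuot_sub (hq : 3 ≤ q) {j : ℕ} (hj : j ≤ q) : sinQuot q (q - j) = sinQuot q j := by
  have hq0 : (q : ℝ) ≠ 0 := by
    have : q ≠ 0 := by omega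
    exact_mod_cast this
  unfold sinQuot
  rw [Nat.cast_sub hj, show ((q : ℝ) - j) * (Real.pi / q) = Real.pi - j * (Real.pi / q) by
    field_simp, Real.sin_pi_sub]

theorem zeroOrGeOne_sinQuot (hq : 3 ≤ q) {j : ℕ} (hj : j ≤ q) : ZeroOrGeOne (sinQuot q j) := by
  have hq0 : (0 : ℝ) < q := by
    have : 0 < q := by omega
    exact_mod_cast this
  have hpi := Real.pi_pos
  have key : ∀ i : ℕ, 2 * i ≤ q → ZeroOrGeOne (sinQuot q i) := by
    intro i hi
    rcases Nat.eq_zero_or_pos i with rfl | hi0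
    · exact Or.inl sinQuot_zero
    · refine Or.inr ((one_le_div (sin_pi_div_pos hq)).2 ?_)
      have h1 : (1 : ℝ) ≤ i := by exact_mod_cast hi0
      have h2 : (2 : ℝ) * i ≤ q := by exact_mod_cast hi
      have ht : 0 < Real.pi / q := by positivity
      have hqt : q * (Real.pi / q) = Real.pi := by field_simp
      apply Real.sin_le_sin_of_le_of_le_pi_div_two <;> nlinarith
  rcases le_total (2 * j) q with h | h
  · exact key j h
  · rw [← sinQuot_sub hq hj]
    exact key _ (by omega)

end sinQuot

/-! ### Columns generated by nonnegative matrices -/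

/-- The vectors `(x, y)` obtained from the two basis vectors by applying the matrices
`(s (j + 1), s (j + 2); s j, s (j + 1))` with `0 ≤ j ≤ q - 2`, where `s` is `sinQuot q`. -/
inductive PosCol (q : ℕ) : ℝ → ℝ → Prop
  | e₁ : PosCol q 1 0
  | e₂ : PosCol q 0 1
  | step (j : ℕ) (hj : j + 2 ≤ q) {x y : ℝ} (h : PosCol q x y) :
      PosCol q (sinQuot q (j + 1) * x + sinQuot q (j + 2) * y)
        (sinQuot q j * x + sinQuot q (j + 1) * y)

/-- The vectors `± v` and `± S v` with `v` in `PosCol q`; here `S (u, v) = (v, -u)`. -/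
def SignedPosCol (q : ℕ) (x y : ℝ) : Prop :=
  ∃ u v, PosCol q u v ∧
    ((x = u ∧ y = v) ∨ (x = -u ∧ y = -v) ∨ (x = v ∧ y = -u) ∨ (x = -v ∧ y = u))

section columns

variable {q : ℕ} {x y : ℝ}

theorem PosCol.zeroOrGeOne (hq : 3 ≤ q) (h : PosCol q x y) :
    ZeroOrGeOne x ∧ ZeroOrGeOne y := by
  induction h with
  | e₁ => exact ⟨Or.inr le_rfl, Or.inl rfl⟩
  | e₂ => exact ⟨Or.inl rfl, Or.inr le_rfl⟩
  | step j hj _ ih =>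
    have h0 := zeroOrGeOne_sinQuot hq (show j ≤ q by omega)
    have h1 := zeroOrGeOne_sinQuot hq (show j + 1 ≤ q by omega)
    have h2 := zeroOrGeOne_sinQuot hq hj
    exact ⟨(h1.mul ih.1).add (h2.mul ih.2), (h0.mul ih.1).add (h1.mul ih.2)⟩

/-- Conjugation by the swap of coordinates exchanges the matrices of index `j` and `q - 2 - j`. -/
theorem PosCol.swap (hq : 3 ≤ q) (h : PosCol q x y) : PosCol q y x := by
  induction h with
  | e₁ => exact .e₂
  | e₂ => exact .e₁
  | step j hj _ ih =>
    have h := PosCol.step (q - (j + 2)) (by omega) ih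
    rw [show q - (j + 2) + 1 = q - (j + 1) by omega, show q - (j + 2) + 2 = q - j by omega,
      sinQuot_sub hq hj, sinQuot_sub hq (show j + 1 ≤ q by omega),
      sinQuot_sub hq (show j ≤ q by omega)] at h
    convert h using 1 <;> ring

/-- The matrix of index `0` is `T`. -/
theorem PosCol.translate (hq : 3 ≤ q) (h : PosCol q x y) : PosCol q (x + lam q * y) y := by
  have h := PosCol.step 0 (by omega) h
  simpa [sinQuot_zero, sinQuot_one hq, sinQuot_two hq] using h

namespace SignedPosCol

theorem neg (h : SignedPosCol q x y) : SignedPosCol q (-x) (-y) := by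
  obtain ⟨u, v, h, ⟨rfl, rfl⟩ | ⟨rfl, rfl⟩ | ⟨rfl, rfl⟩ | ⟨rfl, rfl⟩⟩ := h <;>
    exact ⟨_, _, h, by simp⟩

theorem rotate (h : SignedPosCol q x y) : SignedPosCol q y (-x) := by
  obtain ⟨u, v, h, ⟨rfl, rfl⟩ | ⟨rfl, rfl⟩ | ⟨rfl, rfl⟩ | ⟨rfl, rfl⟩⟩ := h <;>
    exact ⟨_, _, h, by simp⟩

theorem reflect (hq : 3 ≤ q) (h : SignedPosCol q x y) : SignedPosCol q x (-y) := by
  obtain ⟨u, v, h, ⟨rfl, rfl⟩ | ⟨rfl, rfl⟩ | ⟨rfl, rfl⟩ | ⟨rfl, rfl⟩⟩ := h <;>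
    exact ⟨_, _, h.swap hq, by simp⟩

theorem of_posCol (h : PosCol q x y) : SignedPosCol q x y :=
  ⟨x, y, h, Or.inl ⟨rfl, rfl⟩⟩

theorem of_neg (h : SignedPosCol q (-x) (-y)) : SignedPosCol q x y := by
  simpa using h.neg

/-- Stability under `T S`: it maps the matrix of index `j` to minus the one of index `j + 1`, and
the matrix of index `q - 1` would be `-S`. -/
theorem translate_rotate (hq : 3 ≤ q) (h : PosCol q x y) :
    SignedPosCol q (y - lam q * x) (-x) := by
  cases h with
  | e₁ =>
    apply of_neg
    simpa using of_posCol (PosCol.e₂.translate hq)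
  | e₂ => simpa using of_posCol PosCol.e₁
  | step j hj h =>
    rename_i x y
    have e2 := sinQuot_add_two (q := q) j
    have e3 := sinQuot_add_two (q := q) (j + 1)
    rcases Nat.lt_or_ge (j + 2) q with hlt | hge
    · apply of_neg
      convert of_posCol (PosCol.step (j + 1) (by omega) h) using 1
      · linear_combination (-x) * e2 - y * e3
      · ring
    · obtain rfl : q = j + 2 := by omega
      have hz : sinQuot (j + 2) (j + 2) = 0 := by
        simpa [sinQuot_zero] using sinQuot_sub hq (Nat.zero_le (j + 2))
      have h1 : sinQuot (j + 2) (j + 1) = 1 := by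
        simpa [sinQuot_one hq] using sinQuot_sub hq (show 1 ≤ j + 2 by omega)
      rw [hz, h1] at e2
      rw [hz, h1]
      convert (of_posCol h).rotate using 1
      · linear_combination x * e2
      · ring

theorem translate (hq : 3 ≤ q) (h : SignedPosCol q x y) :
    SignedPosCol q (x + lam q * y) y := by
  obtain ⟨u, v, h, ⟨rfl, rfl⟩ | ⟨rfl, rfl⟩ | ⟨rfl, rfl⟩ | ⟨rfl, rfl⟩⟩ := h
  · exact of_posCol (h.translate hq)
  · convert (of_posCol (h.translate hq)).neg using 1
    ring
  · convert translate_rotate hq h using 1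
    ring
  · convert (translate_rotate hq h).neg using 1 <;> ring

theorem translate_neg (hq : 3 ≤ q) (h : SignedPosCol q x y) :
    SignedPosCol q (x - lam q * y) y := by
  -- `diag (1, -1)` conjugates `T` to `T⁻¹`.
  simpa [← sub_eq_add_neg] using ((h.reflect hq).translate hq).reflect hq

theorem zeroOrGeOne_abs (hq : 3 ≤ q) (h : SignedPosCol q x y) :
    ZeroOrGeOne |x| ∧ ZeroOrGeOne |y| := by
  obtain ⟨u, v, h, hxy⟩ := h
  have hu := (h.zeroOrGeOne hq).1
  have hv := (h.zeroOrGeOne hq).2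
  have hu' := abs_of_nonneg hu.nonneg
  have hv' := abs_of_nonneg hv.nonneg
  obtain ⟨rfl, rfl⟩ | ⟨rfl, rfl⟩ | ⟨rfl, rfl⟩ | ⟨rfl, rfl⟩ := hxy <;>
    simp only [abs_neg, hu', hv', hu, hv, and_self]

end SignedPosCol

end columns

/-! ### The preimage of the Hecke group in `SL(2, ℝ)` -/

open Matrix

/-- The subgroup of `SL(2, ℝ)` generated by `S` and `T`. -/
noncomputable def heckeSL (q : ℕ) : Subgroup (SpecialLinearGroup (Fin 2) ℝ) :=
  Subgroup.closure {matS, matT q}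

section group

variable {q : ℕ}

theorem fin_two_congr {R : Type*} {a b c d a' b' c' d' : R} (ha : a = a') (hb : b = b')
    (hc : c = c') (hd : d = d') : !![a, b; c, d] = !![a', b'; c', d'] := by
  rw [ha, hb, hc, hd]

theorem coe_matS : (matS : Matrix (Fin 2) (Fin 2) ℝ) = !![0, 1; -1, 0] := rfl

theorem coe_matT : (matT q : Matrix (Fin 2) (Fin 2) ℝ) = !![1, lam q; 0, 1] := rfl

theorem matS_mem : matS ∈ heckeSL q := Subgroup.subset_closure (by simp)

theorem matT_mem : matT q ∈ heckeSL q := Subgroup.subset_closure (by simp)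

theorem matS_mul_matS : matS * matS = -1 := by
  ext i j
  rw [Matrix.SpecialLinearGroup.coe_mul]
  fin_cases i <;> fin_cases j <;> simp [coe_matS]

theorem neg_one_mem : (-1 : SpecialLinearGroup (Fin 2) ℝ) ∈ heckeSL q := by
  rw [← matS_mul_matS]
  exact mul_mem matS_mem matS_mem

theorem coe_matT_zpow (m : ℤ) :
    ((matT q ^ m : SpecialLinearGroup (Fin 2) ℝ) : Matrix (Fin 2) (Fin 2) ℝ) =
      !![1, m * lam q; 0, 1] := by
  have hTi : (((matT q)⁻¹ : SpecialLinearGroup (Fin 2) ℝ) : Matrix (Fin 2) (Fin 2) ℝ) =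
      !![1, -lam q; 0, 1] := by
    rw [Matrix.SpecialLinearGroup.coe_inv, coe_matT, adjugate_fin_two_of]
    simp
  induction m using Int.induction_on with
  | zero => simp [one_fin_two]
  | succ n ih =>
    rw [_root_.zpow_add_one, Matrix.SpecialLinearGroup.coe_mul, ih, coe_matT, mul_fin_two]
    apply fin_two_congr <;> push_cast <;> ring
  | pred n ih =>
    rw [_root_.zpow_sub_one, Matrix.SpecialLinearGroup.coe_mul, ih, hTi, mul_fin_two]
    apply fin_two_congr <;> push_cast <;> ring

theorem center_le_heckeSL :
    Subgroup.center (SpecialLinearGroup (Fin 2) ℝ) ≤ heckeSL q := by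
  intro A hA
  rw [Matrix.SpecialLinearGroup.mem_center_iff] at hA
  obtain ⟨r, hr, h⟩ := hA
  rcases sq_eq_one_iff.1 (by simpa using hr : r ^ 2 = 1) with rfl | rfl
  · have : A = 1 := Subtype.ext (by rw [← h]; simp)
    exact this ▸ one_mem _
  · have : A = -1 := Subtype.ext (by rw [← h, map_neg, map_one]; rfl)
    exact this ▸ neg_one_mem

theorem mk_mem_heckeGroup_iff (g : SpecialLinearGroup (Fin 2) ℝ) :
    (QuotientGroup.mk g : ProjectiveSpecialLinearGroup (Fin 2) ℝ) ∈ heckeGroup q ↔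
      g ∈ heckeSL q := by
  have h : heckeGroup q = (heckeSL q).map
      (QuotientGroup.mk' (Subgroup.center (SpecialLinearGroup (Fin 2) ℝ))) := by
    rw [heckeSL, MonoidHom.map_closure, Set.image_pair]
    rfl
  rw [h]
  constructor
  · rintro ⟨k, hk, hkg⟩
    have hc := center_le_heckeSL (q := q) (QuotientGroup.eq.1 hkg)
    simpa using mul_mem hk hc
  · exact fun hg => ⟨g, hg, rfl⟩

/-- `heckeSL q` is normalized by the diagonal matrix with entries `1` and `-1`. -/
theorem exists_reflect_mem {g : SpecialLinearGroup (Fin 2) ℝ} (hg : g ∈ heckeSL q) :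
    ∃ g' ∈ heckeSL q, (g' : Matrix (Fin 2) (Fin 2) ℝ) = !![g 0 0, -g 0 1; -g 1 0, g 1 1] := by
  induction hg using Subgroup.closure_induction with
  | mem x hx =>
    rcases hx with rfl | rfl
    · refine ⟨matS⁻¹, inv_mem matS_mem, ?_⟩
      rw [Matrix.SpecialLinearGroup.coe_inv, adjugate_fin_two]
      simp [coe_matS]
    · refine ⟨(matT q)⁻¹, inv_mem matT_mem, ?_⟩
      rw [Matrix.SpecialLinearGroup.coe_inv, adjugate_fin_two]
      simp [coe_matT]
  | one => exact ⟨1, one_mem _, by simp [one_fin_two]⟩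
  | mul x y _ _ hx hy =>
    obtain ⟨x', hx', ex⟩ := hx
    obtain ⟨y', hy', ey⟩ := hy
    refine ⟨x' * y', mul_mem hx' hy', ?_⟩
    rw [Matrix.SpecialLinearGroup.coe_mul, ex, ey, mul_fin_two]
    simp only [Matrix.SpecialLinearGroup.coe_mul, mul_apply, Fin.sum_univ_two]
    apply fin_two_congr <;> ring
  | inv x _ hx =>
    obtain ⟨x', hx', ex⟩ := hx
    refine ⟨x'⁻¹, inv_mem hx', ?_⟩
    rw [Matrix.SpecialLinearGroup.coe_inv, Matrix.SpecialLinearGroup.coe_inv, ex, adjugate_fin_two_of,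
      adjugate_fin_two]
    simp

end group

/-! ### Columns of elements of the group -/

/-- `(x, y)` is the first column of a matrix in the group generated by `S` and `T`. -/
def IsCol (q : ℕ) (x y : ℝ) : Prop := ∃ g ∈ heckeSL q, g 0 0 = x ∧ g 1 0 = y

section IsCol

variable {q : ℕ} {x y : ℝ}

theorem isCol_one_zero : IsCol q 1 0 := ⟨1, one_mem _, by simp⟩

theorem IsCol.mul_left (h : IsCol q x y) {k : SpecialLinearGroup (Fin 2) ℝ}
    (hk : k ∈ heckeSL q) :
    IsCol q (k 0 0 * x + k 0 1 * y) (k 1 0 * x + k 1 1 * y) := by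
  obtain ⟨g, hg, rfl, rfl⟩ := h
  exact ⟨k * g, mul_mem hk hg, by simp [mul_apply, Fin.sum_univ_two]⟩

theorem IsCol.rotate (h : IsCol q x y) : IsCol q y (-x) := by
  simpa [coe_matS] using h.mul_left matS_mem

theorem IsCol.neg (h : IsCol q x y) : IsCol q (-x) (-y) := h.rotate.rotate

theorem IsCol.translate (h : IsCol q x y) (m : ℤ) : IsCol q (x + m * lam q * y) y := by
  simpa [coe_matT_zpow] using h.mul_left (zpow_mem matT_mem m)

theorem IsCol.reflect (h : IsCol q x y) : IsCol q x (-y) := by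
  obtain ⟨g, hg, rfl, rfl⟩ := h
  obtain ⟨g', hg', e⟩ := exists_reflect_mem hg
  exact ⟨g', hg', by simp [e]⟩

theorem IsCol.swap (h : IsCol q x y) : IsCol q y x := by
  simpa using h.rotate.reflect

/-- The second column of an element of the group is also the first column of another one. -/
theorem isCol_snd {g : SpecialLinearGroup (Fin 2) ℝ} (hg : g ∈ heckeSL q) :
    IsCol q (g 0 1) (g 1 1) := by
  have h : IsCol q (-g 0 1) (-g 1 1) :=
    ⟨g * matS, mul_mem hg matS_mem, by simp [coe_matS, mul_apply, Fin.sum_univ_two]⟩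
  simpa using h.neg

theorem IsCol.signedPosCol (hq : 3 ≤ q) (h : IsCol q x y) : SignedPosCol q x y := by
  obtain ⟨g, hg, rfl, rfl⟩ := h
  have key : ∀ x y, SignedPosCol q x y →
      SignedPosCol q (g 0 0 * x + g 0 1 * y) (g 1 0 * x + g 1 1 * y) := by
    induction hg using Subgroup.closure_induction'' with
    | one => simp
    | mem k hk =>
      intro x y h
      rcases hk with rfl | rfl
      · simpa [coe_matS] using h.rotate
      · simpa [coe_matT] using h.translate hq
    | inv_mem k hk =>
      intro x y h
      rcases hk with rfl | rfl
      · simpa [coe_matS, Matrix.SpecialLinearGroup.coe_inv, adjugate_fin_two] using h.rotate.neg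
      · simpa [coe_matT, Matrix.SpecialLinearGroup.coe_inv, adjugate_fin_two, ← sub_eq_add_neg] using
          h.translate_neg hq
    | mul k l _ _ hk hl =>
      intro x y h
      convert hk _ _ (hl _ _ h) using 1 <;>
        simp only [Matrix.SpecialLinearGroup.coe_mul, mul_apply, Fin.sum_univ_two] <;> ring
  simpa using key 1 0 (.of_posCol .e₁)

theorem IsCol.one_le_abs_snd (hq : 3 ≤ q) (h : IsCol q x y) (hy : y ≠ 0) : 1 ≤ |y| :=
  ((h.signedPosCol hq).zeroOrGeOne_abs hq).2.resolve_left (abs_ne_zero.2 hy)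

theorem IsCol.one_le_abs_fst (hq : 3 ≤ q) (h : IsCol q x y) (hx : x ≠ 0) : 1 ≤ |x| :=
  h.swap.one_le_abs_snd hq hx

/-- If the first column is `(x, 0)`, then the diagonal entries are inverse to each other, and both
are at least `1` in absolute value. -/
theorem IsCol.abs_eq_one (hq : 3 ≤ q) (h : IsCol q x 0) : |x| = 1 := by
  have hx := h
  obtain ⟨g, hg, h0, h1⟩ := h
  have hdet := g.det_coe
  rw [det_fin_two, h0, h1, mul_zero, sub_zero] at hdet
  have hd0 : g 1 1 ≠ 0 := right_ne_zero_of_mul_eq_one hdet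
  have hx0 : x ≠ 0 := left_ne_zero_of_mul_eq_one hdet
  have h1 := hx.one_le_abs_fst hq hx0
  have h2 := (isCol_snd hg).one_le_abs_snd hq hd0
  have h3 : |x| * |g 1 1| = 1 := by rw [← abs_mul, hdet, abs_one]
  nlinarith

theorem isCol_of_abs_eq_one (h : |x| = 1) : IsCol q x 0 := by
  rcases eq_or_eq_neg_of_abs_eq h with rfl | rfl
  · exact isCol_one_zero
  · simpa using isCol_one_zero.neg

theorem IsCol.exists_eq_int_mul_lam (hq : 3 ≤ q) (h : IsCol q x 1) :
    ∃ m : ℤ, x = m * lam q := by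
  have hl := lam_pos hq
  -- The nearest multiple of `λ` is at distance at most `λ / 2 < 1`.
  refine ⟨round (x / lam q), ?_⟩
  by_contra hne
  have h1 := h.translate (-round (x / lam q))
  have h2 := h1.one_le_abs_fst hq (by
    push_cast
    contrapose! hne
    linarith)
  have h3 := abs_sub_round (x / lam q)
  have h4 : x + ((-round (x / lam q) : ℤ) : ℝ) * lam q * 1 =
      (x / lam q - round (x / lam q)) * lam q := by
    push_cast
    field_simp
    ring
  rw [h4, abs_mul, abs_of_pos hl] at h2
  nlinarith [lam_lt_two hq]

/-- A real matrix of determinant `1` lies in the group as soon as both of its columns are columns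
of elements of the group. -/
theorem mem_heckeSL_iff (hq : 3 ≤ q) (g : SpecialLinearGroup (Fin 2) ℝ) :
    g ∈ heckeSL q ↔ IsCol q (g 0 0) (g 1 0) ∧ IsCol q (g 0 1) (g 1 1) := by
  refine ⟨fun hg => ⟨⟨g, hg, rfl, rfl⟩, isCol_snd hg⟩, ?_⟩
  rintro ⟨⟨k, hk, h0, h1⟩, hc⟩
  have hdet := g.det_coe
  have hkdet := k.det_coe
  rw [det_fin_two] at hdet hkdet
  have hki : ((k⁻¹ : SpecialLinearGroup (Fin 2) ℝ) : Matrix (Fin 2) (Fin 2) ℝ) =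
      !![k 1 1, -k 0 1; -k 1 0, k 0 0] := by
    rw [Matrix.SpecialLinearGroup.coe_inv, adjugate_fin_two]
  -- `k⁻¹ g` is `(1, e; 0, 1)`; its second column `(e, 1)` is again a column of the group.
  have hcol := hc.mul_left (inv_mem hk)
  simp only [hki, of_apply, cons_val', cons_val_zero, cons_val_one, cons_val_fin_one] at hcol
  rw [show -k 1 0 * g 0 1 + k 0 0 * g 1 1 = 1 by
    rw [h0, h1]; linear_combination hdet] at hcol
  obtain ⟨m, hm⟩ := hcol.exists_eq_int_mul_lam hq
  have hg : g = k * matT q ^ m := by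
    rw [← inv_mul_eq_iff_eq_mul]
    apply Subtype.ext
    rw [Matrix.SpecialLinearGroup.coe_mul, coe_matT_zpow, ← hm, hki,
      eta_fin_two (g : Matrix (Fin 2) (Fin 2) ℝ), mul_fin_two, ← h0, ← h1]
    rw [← h0, ← h1] at hdet
    apply fin_two_congr
    · linear_combination hkdet
    · rfl
    · ring
    · linear_combination hdet
  rw [hg]
  exact mul_mem hk (zpow_mem matT_mem m)

end IsCol

/-! ### The pseudo-Euclidean algorithm on columns -/

section algorithm

variable {q : ℕ}

theorem coe_peRem (x y : lamRing q) :
    (peRem q x y : ℝ) = x - y * (peQuot q x y * lam q) := by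
  simp [peRem, lamElt]

theorem abs_peRem_le (hq : 3 ≤ q) (x y : lamRing q) (hy : y ≠ 0) :
    |(peRem q x y : ℝ)| ≤ lam q / 2 * |(y : ℝ)| := by
  have h := (peQuot_unique hq x y hy _).2 rfl
  rw [← coe_peRem, abs_mul, abs_of_pos (lam_pos hq)] at h
  rw [abs_le]
  constructor <;> linarith

theorem isCol_peRem_iff (x y : lamRing q) : IsCol q y (peRem q x y) ↔ IsCol q x y := by
  rw [coe_peRem]
  constructor
  · intro h
    convert h.swap.translate (peQuot q x y) using 1
    ring
  · intro h
    apply IsCol.swap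
    convert h.translate (-peQuot q x y) using 1
    push_cast
    ring

variable {a b : lamRing q}

theorem rem_zero : rem q a b 0 = b := rfl

theorem rem_succ_of_eq_zero {n : ℕ} (h : rem q a b n = 0) : rem q a b (n + 1) = 0 :=
  if_pos h

theorem rem_succ_of_ne_zero {n : ℕ} (h : rem q a b n ≠ 0) :
    rem q a b (n + 1) = peRem q (peState q a b n).1 (rem q a b n) :=
  if_neg h

theorem rem_ne_zero_of_le {m n : ℕ} (hmn : m ≤ n) (h : rem q a b n ≠ 0) : rem q a b m ≠ 0 := by
  induction n, hmn using Nat.le_induction with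
  | base => exact h
  | succ n _ ih => exact ih fun h0 => h (rem_succ_of_eq_zero h0)

/-- As long as no remainder vanishes, consecutive remainders form a column of the group if and
only if the starting pair does. -/
theorem isCol_peState_iff {n : ℕ} (h : ∀ k < n, rem q a b k ≠ 0) :
    IsCol q (peState q a b n).1 (rem q a b n) ↔ IsCol q a b := by
  induction n with
  | zero => rfl
  | succ n ih =>
    rw [← ih fun k hk => h k (by omega), rem_succ_of_ne_zero (h n (by omega))]
    exact isCol_peRem_iff _ _

theorem exists_rem_eq_zero (hq : 3 ≤ q) (h : IsCol q a b) : ∃ n, rem q a b n = 0 := by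
  by_contra! hne
  have hl := lam_pos hq
  have hdecay : ∀ n, |(rem q a b n : ℝ)| ≤ (lam q / 2) ^ n * |(b : ℝ)| := by
    intro n
    induction n with
    | zero => simp [rem_zero]
    | succ n ih =>
      rw [rem_succ_of_ne_zero (hne n)]
      calc _ ≤ lam q / 2 * |(rem q a b n : ℝ)| := abs_peRem_le hq _ _ (hne n)
        _ ≤ lam q / 2 * ((lam q / 2) ^ n * |(b : ℝ)|) := by gcongr
        _ = _ := by ring
  have hlim : Filter.Tendsto (fun n => (lam q / 2) ^ n * |(b : ℝ)|) Filter.atTop (nhds 0) := by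
    simpa using (tendsto_pow_atTop_nhds_zero_of_lt_one (by linarith)
      (by linarith [lam_lt_two hq])).mul_const |(b : ℝ)|
  obtain ⟨n, hn⟩ := (hlim.eventually_lt_const one_pos).exists
  have hcol := (isCol_peState_iff fun k (_ : k < n) => hne k).2 h
  have := hcol.one_le_abs_snd hq (by exact_mod_cast hne n)
  linarith [hdecay n]

/-- If the algorithm stops at the remainder `rₙ`, then the starting pair is a column of the group
if and only if `|rₙ| = 1`. -/
theorem isCol_iff_abs_rem_eq_one (hq : 3 ≤ q) {n : ℕ} (h : rem q a b n ≠ 0)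
    (h' : rem q a b (n + 1) = 0) : IsCol q a b ↔ |(rem q a b n : ℝ)| = 1 := by
  have hiff := isCol_peState_iff (n := n + 1) fun k hk =>
    rem_ne_zero_of_le (Nat.lt_succ_iff.1 hk) h
  rw [h'] at hiff
  rw [← hiff]
  exact ⟨fun hc => IsCol.abs_eq_one hq hc, fun hc => isCol_of_abs_eq_one hc⟩

theorem peGcd_eq_one_iff (hq : 3 ≤ q) : peGcd q a b = 1 ↔ IsCol q a b := by
  classical
  unfold peGcd
  split_ifs with hb ha hn
  · subst hb
    exact ⟨fun h => isCol_of_abs_eq_one h, fun h => IsCol.abs_eq_one hq h⟩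
  · subst ha
    exact ⟨fun h => (isCol_of_abs_eq_one h).swap, fun h => IsCol.abs_eq_one hq h.swap⟩
  · exact (isCol_iff_abs_rem_eq_one hq (Nat.find_spec hn).1 (Nat.find_spec hn).2).symm
  · refine ⟨fun h => absurd h zero_ne_one, fun h => absurd ?_ hn⟩
    have hz := exists_rem_eq_zero hq h
    obtain ⟨n, hfind⟩ := Nat.exists_eq_succ_of_ne_zero (n := Nat.find hz) fun h0 =>
      hb (by simpa [h0, rem_zero] using Nat.find_spec hz)
    exact ⟨n, Nat.find_min hz (by omega), by simpa [hfind] using Nat.find_spec hz⟩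

end algorithm

end Hecke

theorem proposition3p7 (q : ℕ) (hq : 3 ≤ q)
    (A : Matrix.ProjectiveSpecialLinearGroup (Fin 2) (Hecke.lamRing q))
    (M : Matrix.SpecialLinearGroup (Fin 2) (Hecke.lamRing q))
    (hMA : (QuotientGroup.mk M : Matrix.ProjectiveSpecialLinearGroup (Fin 2) (Hecke.lamRing q)) = A)
    (a b c d : Hecke.lamRing q)
    (hM : (M : Matrix (Fin 2) (Fin 2) (Hecke.lamRing q)) = !![a, c; b, d]) :
    (Hecke.toPSLReal q A ∈ Hecke.heckeGroup q ↔
      Hecke.peGcd q a b = 1 ∧ Hecke.peGcd q c d = 1) ∧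
    (Hecke.peGcd q a b < 1 → Hecke.toPSLReal q A ∉ Hecke.heckeGroup q) ∧
    (b ≠ 0 → |(b : ℝ)| < 1 → Hecke.toPSLReal q A ∉ Hecke.heckeGroup q) := by
  have key : Hecke.toPSLReal q A ∈ Hecke.heckeGroup q ↔
      Hecke.peGcd q a b = 1 ∧ Hecke.peGcd q c d = 1 := by
    rw [← hMA, Hecke.peGcd_eq_one_iff hq, Hecke.peGcd_eq_one_iff hq]
    refine (Hecke.mk_mem_heckeGroup_iff _).trans ((Hecke.mem_heckeSL_iff hq _).trans ?_)
    simp [hM]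
  refine ⟨key, fun hlt hA => hlt.ne (key.1 hA).1, fun hb hlt hA => hlt.not_ge ?_⟩
  exact ((Hecke.peGcd_eq_one_iff hq).1 (key.1 hA).1).one_le_abs_snd hq (by exact_mod_cast hb)
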